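/- Let $M$ be a free abelian group of finite rank, $N=\mathrm{Hom}(M,\mathbb{Z})$, let $\mathbb{T}_N=\mathrm{Hom}(M,\mathbb{C}^*)$ be the complex torus with coordinate ring $\mathbb{C}[M]$, and let $\mathbb{U}_N=\mathrm{Hom}(M,\mathbb{U})$ be the compact real torus, where $\mathbb{U}=\{z\in\mathbb{C}:|z|=1\}$. Let $\arg\colon\mathbb{T}_N\to\mathbb{U}_N$ be the map induced by $\mathbb{C}^*\to\mathbb{U}$, $z\mapsto z/|z|$. Let $X\subset\mathbb{T}_N$ be a subvariety, that is, the set of common zeros of an ideal of $\mathbb{C}[M]$ (not necessarily irreducible), and let $\mathit{co}\mathscr{A}(X)=\arg(X)\subset\mathbb{U}_N$ be its coamoeba. Let $\mathbb{T}_X\subset\mathbb{T}_N$ be the largest subtorus that acts on $X$ by translation, where a subtorus is the image in $\mathbb{T}_N=N\otimes_{\mathbb Z}\mathbb{C}^*$ of $L\otimes_{\mathbb Z}\mathbb{C}^*$ for a subgroup $L\subset N$. Then \[ \dim \mathit{co}\mathscr{A}(X)\ \leq\ \min\{\dim\mathbb{T}_N,\ 2\dim X-\dim\mathbb{T}_X\}.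 \] Here $\dim\mathbb{T}_N$, $\dim X$ and $\dim\mathbb{T}_X$ are complex dimensions of algebraic varieties (Krull dimensions of coordinate rings), and $\dim\mathit{co}\mathscr{A}(X)$ is the real dimension of the semialgebraic set $\mathit{co}\mathscr{A}(X)$, i.e. the Krull dimension of the ring of real polynomial functions on it (the ring of functions generated over $\mathbb{R}$ by the real and imaginary parts of the characters $u\mapsto u(m)$, $m\in M$, of $\mathbb{U}_N$). The empty set has dimension $-\infty$. -/

import Mathlib

noncomputable section

namespace Coamoeba

/-- The complex torus `𝕋_N = Hom(M, ℂˣ)`, where `N = Hom(M, ℤ)`. -/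
abbrev ComplexTorus (M : Type*) [AddCommGroup M] : Type _ := Multiplicative M →* ℂˣ

/-- The compact real torus `𝕌_N = Hom(M, 𝕌)`, where `𝕌` is the group of complex numbers of
norm one. -/
abbrev RealTorus (M : Type*) [AddCommGroup M] : Type _ := Multiplicative M →* Circle

/-- The argument homomorphism `ℂˣ → 𝕌`, `z ↦ z / |z|`. -/
def argHom : ℂˣ →* Circle :=
  MonoidHom.mk' (fun z => ⟨(z : ℂ) / (‖(z : ℂ)‖ : ℂ), mem_sphere_zero_iff_norm.2 (by simp)⟩)
    fun a b => Circle.ext (show ((a * b : ℂˣ) : ℂ) / (‖((a * b : ℂˣ) : ℂ)‖ : ℂ) =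
      (a : ℂ) / (‖(a : ℂ)‖ : ℂ) * ((b : ℂ) / (‖(b : ℂ)‖ : ℂ)) by simp [mul_div_mul_comm])

variable {M : Type*} [AddCommGroup M]

/-- The argument map `𝕋_N → 𝕌_N`. -/
def argMap (x : ComplexTorus M) : RealTorus M := argHom.comp x

/-- The coamoeba of a subset of `𝕋_N`: its image under the argument map. -/
def coamoeba (X : Set (ComplexTorus M)) : Set (RealTorus M) := argMap '' X

/-- Evaluation of Laurent polynomials, the elements of the group ring `ℂ[M]`, at a point of
`𝕋_N`: the monomial with exponent `m` takes the value `x m`. -/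
def evalAt (x : ComplexTorus M) : AddMonoidAlgebra ℂ M →ₐ[ℂ] ℂ :=
  AddMonoidAlgebra.lift ℂ ℂ M ((Units.coeHom ℂ).comp x)

/-- A (possibly reducible) subvariety of `𝕋_N`: the set of common zeros of an ideal of Laurent
polynomials. -/
def IsSubvariety (X : Set (ComplexTorus M)) : Prop :=
  ∃ I : Ideal (AddMonoidAlgebra ℂ M), X = {x | ∀ f ∈ I, evalAt x f = 0}

/-- The ideal of all Laurent polynomials that vanish on `X`. -/
def vanishingIdeal (X : Set (ComplexTorus M)) : Ideal (AddMonoidAlgebra ℂ M) :=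
  ⨅ x ∈ X, RingHom.ker (evalAt x)

/-- The (complex) dimension of a subvariety: the Krull dimension of its coordinate ring
(`⊥` for the empty set). -/
def varietyDim (X : Set (ComplexTorus M)) : WithBot ℕ∞ :=
  ringKrullDim (AddMonoidAlgebra ℂ M ⧸ vanishingIdeal X)

/-- The ring of real polynomial functions on a subset `S` of the real algebraic variety `𝕌_N`.
It is generated by the real and imaginary parts of the characters `u ↦ u m`. -/
def polynomialFunctions (S : Set (RealTorus M)) : Subalgebra ℝ (S → ℝ) :=
  Algebra.adjoin ℝ
    (Set.range (fun (m : M) (u : S) => ((u : RealTorus M) (Multiplicative.ofAdd m) : ℂ).re) ∪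
      Set.range (fun (m : M) (u : S) => ((u : RealTorus M) (Multiplicative.ofAdd m) : ℂ).im))

/-- The (real) dimension of a semialgebraic subset of `𝕌_N`: the Krull dimension of its ring of
real polynomial functions (`⊥` for the empty set). This is the definition of the dimension of a
semialgebraic set of Bochnak, Coste and Roy. -/
def semialgebraicDim (S : Set (RealTorus M)) : WithBot ℕ∞ :=
  ringKrullDim (polynomialFunctions S)

/-- The one-parameter subgroup `t ↦ t ^ w` of `𝕋_N` given by `w ∈ N = Hom(M, ℤ)`; the point
`t ^ w` is the homomorphism `m ↦ t ^ ⟨m, w⟩`. -/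
def oneParam (w : M →+ ℤ) : ℂˣ →* ComplexTorus M where
  toFun t :=
    { toFun := fun m => t ^ w m.toAdd
      map_one' := by simp
      map_mul' := fun a b => by simp [zpow_add] }
  map_one' := by ext; simp
  map_mul' a b := by ext; simp [mul_zpow]

/-- The image in `𝕋_N` of the torus `𝕋_L = L ⊗ ℂˣ` of a subgroup `L ⊆ N`: it is generated by the
one-parameter subgroups with directions in `L`. -/
def subtorusOf (L : AddSubgroup (M →+ ℤ)) : Subgroup (ComplexTorus M) :=
  ⨆ w ∈ L, (oneParam w).range

/-- The subtori of `𝕋_N`. -/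
def IsSubtorus (T : Subgroup (ComplexTorus M)) : Prop :=
  ∃ L : AddSubgroup (M →+ ℤ), T = subtorusOf L

/-- The subgroup `T` of `𝕋_N` acts on `X` by translation. -/
def ActsOn (T : Subgroup (ComplexTorus M)) (X : Set (ComplexTorus M)) : Prop :=
  ∀ t ∈ T, ∀ x ∈ X, t * x ∈ X

/-- `T` is the largest subtorus of `𝕋_N` that acts on `X`. -/
def IsLargestSubtorusActingOn (T : Subgroup (ComplexTorus M)) (X : Set (ComplexTorus M)) : Prop :=
  IsGreatest {T' : Subgroup (ComplexTorus M) | IsSubtorus T' ∧ ActsOn T' X} T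

/-- There always is a largest subtorus that acts on `X`. -/
theorem exists_isLargestSubtorusActingOn (X : Set (ComplexTorus M)) :
    ∃ T : Subgroup (ComplexTorus M), IsLargestSubtorusActingOn T X := by
  let S : Submonoid (ComplexTorus M) :=
    { carrier := {t | ∀ x ∈ X, t * x ∈ X}
      one_mem' := fun x hx => by rwa [one_mul]
      mul_mem' := fun {a b} ha hb x hx => by
        rw [mul_assoc]
        exact ha _ (hb x hx) }
  let L : AddSubgroup (M →+ ℤ) :=
    { carrier := {w | ∀ t : ℂˣ, oneParam w t ∈ S}
      zero_mem' := fun t => by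
        have h : oneParam (0 : M →+ ℤ) t = 1 := by ext; simp [oneParam]
        rw [h]
        exact S.one_mem
      add_mem' := fun {a b} ha hb t => by
        have h : oneParam (a + b) t = oneParam a t * oneParam b t := by
          ext; simp [oneParam, zpow_add]
        rw [h]
        exact S.mul_mem (ha t) (hb t)
      neg_mem' := fun {a} ha t => by
        have h : oneParam (-a) t = oneParam a t⁻¹ := by ext; simp [oneParam]
        rw [h]
        exact ha _ }
  refine ⟨subtorusOf L, ⟨⟨L, rfl⟩, ?_⟩, ?_⟩
  · intro t ht
    change t ∈ S
    refine Subgroup.iSup_induction (C := fun t => t ∈ S) _ ht (fun w y hy => ?_) S.one_mem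
      (fun a b => S.mul_mem)
    refine Subgroup.iSup_induction (C := fun t => t ∈ S) _ hy (fun hw z hz => ?_) S.one_mem
      (fun a b => S.mul_mem)
    obtain ⟨c, rfl⟩ := hz
    exact hw c
  · rintro T ⟨⟨L', rfl⟩, hT⟩
    refine iSup₂_le fun w hw => ?_
    have hwL : w ∈ L := fun t x hx =>
      hT _ (le_iSup₂ (f := fun (w : M →+ ℤ) (_ : w ∈ L') => (oneParam w).range) w hw ⟨t, rfl⟩) x hx
    exact le_iSup₂ (f := fun (w : M →+ ℤ) (_ : w ∈ L) => (oneParam w).range) w hwL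

end Coamoeba

end

/-!
The real polynomial functions on the coamoeba become, up to an integral extension, the Laurent
polynomials in the functions `χ_m ∘ arg` on `X`, where `χ_m` is the character with exponent `m`.
Since `(χ_m ∘ arg)² = χ_m · conj χ_{-m}`, these are integral over `ℂ[z, conj z]` for a Noether
normalization `z` of the coordinate ring of `X`, which has `2 dim X` generators.

Let `L` be the group of one-parameter subgroups that defines the subtorus. Translation by the
points `2 ^ w` with `w ∈ L` preserves `X` and all arguments, and it multiplies `χ_m` by
`2 ^ ⟨m, w⟩`. Independence of the characters `w ↦ 2 ^ ⟨m, w⟩` shows that as many `χ_m` as the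
dimension of the subtorus are algebraically independent over the functions of the arguments. They
are integral over `ℂ[z, conj z]` as well, which leaves room for at most `2 dim X` minus that
dimension algebraically independent functions of the arguments.
-/

section Integral

variable {K L A B : Type*} [CommRing K] [CommRing L] [CommRing A] [CommRing B]

theorem ringKrullDim_eq_of_isIntegral_of_injective [Algebra A B] [Algebra.IsIntegral A B]
    (h : Function.Injective (algebraMap A B)) : ringKrullDim B = ringKrullDim A := by
  apply le_antisymm
  · exact Order.krullDim_le_of_strictMono (PrimeSpectrum.comap (algebraMap A B))
      fun p q hpq => Ideal.IsIntegral.comap_lt_comap (R := A) hpq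
  · refine iSup_le fun chain => ?_
    obtain ⟨P, -, hP, hPchain⟩ := Ideal.exists_ideal_over_prime_of_isIntegral
      chain.head.asIdeal (⊥ : Ideal B)
      (by simp [← RingHom.ker_eq_comap_bot, (RingHom.injective_iff_ker_eq_bot _).1 h])
    have : P.LiesOver chain.head.asIdeal := ⟨hPchain.symm⟩
    obtain ⟨lift, hlift, -⟩ := Ideal.exists_ltSeries_of_hasGoingUp chain P
    exact hlift ▸ Order.LTSeries.length_le_krullDim lift

theorem ringKrullDim_eq_of_le_of_forall_isIntegral [Algebra K A] [Algebra L A]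
    {S : Subalgebra K A} {T : Subalgebra L A} (hle : ∀ s ∈ S, s ∈ T)
    (hint : ∀ t ∈ T, IsIntegral S t) : ringKrullDim T = ringKrullDim S := by
  let inclusion : S →+* T := (algebraMap S A).codRestrict T fun s => hle s s.2
  let _ : Algebra S T := inclusion.toAlgebra
  have : IsScalarTower S T A := IsScalarTower.of_algebraMap_eq' rfl
  have : Algebra.IsIntegral S T :=
    ⟨fun t => (isIntegral_algebraMap_iff (A := T) (B := A) Subtype.val_injective).1 (hint t t.2)⟩
  exact ringKrullDim_eq_of_isIntegral_of_injective fun a b h =>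
    Subtype.ext (congrArg (algebraMap T A) h)

theorem isIntegral_map_of_forall_mem [Algebra K A] [Algebra L B] {S : Subalgebra K A}
    {T : Subalgebra L B} (σ : A →+* B) (hσ : ∀ a ∈ S, σ a ∈ T) {a : A} (ha : IsIntegral S a) :
    IsIntegral T (σ a) :=
  ha.map_of_comp_eq ((σ.comp (algebraMap S A)).codRestrict T fun s => hσ s s.2) σ rfl

theorem isIntegral_of_mul_eq_one_of_add_mem [Algebra K A] {S : Subalgebra K A} {a b : A}
    (hmul : a * b = 1) (hadd : a + b ∈ S) : IsIntegral S a := by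
  refine ⟨Polynomial.X ^ 2 - Polynomial.C ⟨a + b, hadd⟩ * Polynomial.X + 1, by monicity!, ?_⟩
  simp only [Polynomial.eval₂_add, Polynomial.eval₂_sub, Polynomial.eval₂_mul,
    Polynomial.eval₂_pow, Polynomial.eval₂_X, Polynomial.eval₂_C, Polynomial.eval₂_one]
  change a ^ 2 - (a + b) * a + 1 = 0
  linear_combination -hmul

end Integral

section AlgebraicIndependence

variable {ι κ K A : Type*} [CommRing K] [CommRing A] [Algebra K A]

theorem exists_isPrime_algebraicIndependent_quotient [IsDomain K] {x : ι → A}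
    (hx : AlgebraicIndependent K x) :
    ∃ P : Ideal A, P.IsPrime ∧ AlgebraicIndependent K (Ideal.Quotient.mk P ∘ x) := by
  obtain ⟨P, hP, hcomap⟩ := Ideal.exists_comap_eq_of_mem_minimalPrimes_of_injective
    (f := (MvPolynomial.aeval (R := K) x).toRingHom) hx ⊥
    (by simp [IsDomain.minimalPrimes_eq_singleton_bot])
  refine ⟨P, hP, algebraicIndependent_iff.2 fun p hp => ?_⟩
  have hmem : MvPolynomial.aeval x p ∈ P := by
    rw [← Ideal.Quotient.eq_zero_iff_mem, ← hp]
    exact MvPolynomial.comp_aeval_apply x (Ideal.Quotient.mkₐ K P) p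
  rwa [← Ideal.mem_bot, ← hcomap]

theorem card_le_card_of_isAlgebraic_adjoin [Fintype ι] [Fintype κ] [IsDomain A] {x : ι → A}
    (hx : AlgebraicIndependent K x) (z : κ → A)
    (h : ∀ i, IsAlgebraic (Algebra.adjoin K (Set.range z)) (x i)) :
    Fintype.card ι ≤ Fintype.card κ := by
  have : FaithfulSMul K A := (faithfulSMul_iff_algebraMap_injective K A).2 hx.algebraMap_injective
  have : Nontrivial K := (algebraMap K A).domain_nontrivial
  let matroid := AlgebraicIndependent.matroid K A
  have hindep : matroid.Indep (Set.range x) :=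
    AlgebraicIndependent.matroid_indep_iff.2 hx.coe_range
  have hsub : Set.range x ⊆ matroid.closure (Set.range z) := by
    rw [AlgebraicIndependent.matroid_closure_eq]
    exact Set.range_subset_iff.2 h
  have hencard : (Set.range x).encard ≤ (Set.range z).encard :=
    calc (Set.range x).encard ≤ matroid.eRk (matroid.closure (Set.range z)) :=
          hindep.encard_le_eRk_of_subset hsub
      _ = matroid.eRk (Set.range z) := matroid.eRk_closure_eq _
      _ ≤ (Set.range z).encard := matroid.eRk_le_encard _
  rw [← Set.image_univ, hx.injective.encard_image, ← Set.image_univ] at hencard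
  simpa using hencard.trans (Set.encard_image_le z Set.univ)

theorem card_le_card_of_isIntegral_adjoin [Fintype ι] [Fintype κ] [IsDomain K] {x : ι → A}
    (hx : AlgebraicIndependent K x) (z : κ → A)
    (h : ∀ i, IsIntegral (Algebra.adjoin K (Set.range z)) (x i)) :
    Fintype.card ι ≤ Fintype.card κ := by
  obtain ⟨P, hP, hxP⟩ := exists_isPrime_algebraicIndependent_quotient hx
  have hmap : Algebra.adjoin K (Set.range z) ≤
      (Algebra.adjoin K (Set.range (Ideal.Quotient.mk P ∘ z))).comap (Ideal.Quotient.mkₐ K P) :=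
    Algebra.adjoin_le <| Set.range_subset_iff.2 fun j => Algebra.subset_adjoin ⟨j, rfl⟩
  exact card_le_card_of_isAlgebraic_adjoin hxP _ fun i =>
    (isIntegral_map_of_forall_mem (Ideal.Quotient.mk P) hmap (h i)).isAlgebraic

end AlgebraicIndependence

section NoetherNormalization

variable {κ K A : Type*} [Field K] [CommRing A] [Algebra K A]

theorem exists_algebraicIndependent_isIntegral_ringKrullDim_eq (S : Subalgebra K A) [Nontrivial S]
    [Algebra.FiniteType K S] :
    ∃ (d : ℕ) (x : Fin d → S), AlgebraicIndependent K x ∧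
      (∀ s ∈ S, IsIntegral (Algebra.adjoin K (Set.range fun i => (x i : A))) s) ∧
      ringKrullDim S = d := by
  obtain ⟨d, g, hg, hint⟩ := exists_integral_inj_algHom_of_fg K S
  have hgx : MvPolynomial.aeval (fun i => g (MvPolynomial.X i)) = g := by ext; simp
  have hgxA : MvPolynomial.aeval (fun i => (g (MvPolynomial.X i) : A)) = S.val.comp g := by
    ext; simp
  refine ⟨d, fun i => g (MvPolynomial.X i), ?_, fun s hs => ?_, ?_⟩
  · rwa [AlgebraicIndependent, hgx]
  · have hmem (p) : S.val.comp g p ∈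
        Algebra.adjoin K (Set.range fun i => (g (MvPolynomial.X i) : A)) := by
      rw [Algebra.adjoin_range_eq_range_aeval, hgxA]
      exact ⟨p, rfl⟩
    algebraize [g.toRingHom]
    have hs' : IsIntegral (MvPolynomial (Fin d) K) (⟨s, hs⟩ : S) := hint ⟨s, hs⟩
    exact hs'.map_of_comp_eq ((S.val.comp g).codRestrict _ hmem).toRingHom S.val.toRingHom rfl
  · algebraize [g.toRingHom]
    have : Algebra.IsIntegral (MvPolynomial (Fin d) K) S := ⟨hint⟩
    rw [ringKrullDim_eq_of_isIntegral_of_injective (A := MvPolynomial (Fin d) K) hg]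
    simp

theorem ringKrullDim_le_card_of_isIntegral_adjoin [Fintype κ] (S : Subalgebra K A)
    [Algebra.FiniteType K S] (z : κ → A)
    (h : ∀ s ∈ S, IsIntegral (Algebra.adjoin K (Set.range z)) s) :
    ringKrullDim S ≤ Fintype.card κ := by
  cases subsingleton_or_nontrivial S
  · exact ringKrullDim_eq_bot_of_subsingleton.trans_le bot_le
  obtain ⟨d, x, hx, -, hd⟩ := exists_algebraicIndependent_isIntegral_ringKrullDim_eq S
  have hcard := card_le_card_of_isIntegral_adjoin (hx.map' (f := S.val) Subtype.val_injective) z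
    fun i => h _ (x i).2
  rw [Fintype.card_fin] at hcard
  exact hd ▸ mod_cast hcard

end NoetherNormalization

section Semiinvariants

variable {ι G X R K : Type*} [MulOneClass G] [CommRing R] [CommRing K] [IsDomain K] [Algebra R K]

theorem algebraicIndependent_of_semiinvariant (act : G → X → X) (θ : ι → G →* K)
    (hθ : Function.Injective fun α : ι →₀ ℕ => α.prod fun i n => θ i ^ n)
    (B : Subalgebra R (X → K)) (hB : ∀ f ∈ B, ∀ g x, f (act g x) = f x) (χ : ι → X → K)
    (hχ : ∀ i g x, χ i (act g x) = θ i g * χ i x) (hχ₀ : ∀ i x, χ i x ≠ 0) :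
    AlgebraicIndependent B χ := by
  refine algebraicIndependent_iff.2 fun p hp => ?_
  ext α x
  -- Moving `x` by `g` turns the relation into a linear relation between the characters `Θ β`
  -- of `G`, which are distinct, so that Dedekind's lemma applies.
  let Θ (β : ι →₀ ℕ) : G →* K := ∏ i ∈ β.support, θ i ^ β i
  let coeffAt (β : ι →₀ ℕ) : K := (MvPolynomial.coeff β p).1 x
  let monomialAt (β : ι →₀ ℕ) : K := ∏ i ∈ β.support, χ i x ^ β i
  have hΘ : LinearIndependent K fun β => ⇑(Θ β) := (linearIndependent_monoidHom G K).comp Θ hθ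
  have hrel : ∑ β ∈ p.support, (coeffAt β * monomialAt β) • ⇑(Θ β) = 0 := by
    funext g
    have h := congrFun hp (act g x)
    simp only [MvPolynomial.aeval_def, MvPolynomial.eval₂_eq, Finset.sum_apply, Pi.mul_apply,
      Finset.prod_apply, Pi.pow_apply, hχ, mul_pow, Finset.prod_mul_distrib] at h
    simp only [Finset.sum_apply, Pi.smul_apply, smul_eq_mul, Θ, MonoidHom.finsetProd_apply,
      MonoidHom.pow_apply]
    refine (Finset.sum_congr rfl fun β _ => ?_).trans h
    have hinv : coeffAt β = algebraMap B (X → K) (MvPolynomial.coeff β p) (act g x) :=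
      (hB _ (MvPolynomial.coeff β p).2 g x).symm
    rw [← hinv]
    ring
  by_cases hα : α ∈ p.support
  · have hmonomial : monomialAt α ≠ 0 :=
      Finset.prod_ne_zero_iff.2 fun i _ => pow_ne_zero _ (hχ₀ i x)
    exact (mul_eq_zero.1 (linearIndependent_iff'.1 hΘ p.support _ hrel α hα)).resolve_right
      hmonomial
  · rw [MvPolynomial.notMem_support_iff.1 hα, MvPolynomial.coeff_zero]

end Semiinvariants

noncomputable section

namespace Coamoeba

variable {M Y : Type*} [AddCommGroup M]

section RegularFunctions

/-- The function on `Y` given by the monomial with exponent `m` through a map `φ` from `Y`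
to `𝕋_N`. -/
def character (φ : Y → ComplexTorus M) (m : M) : Y → ℂ := fun y => φ y (Multiplicative.ofAdd m)

/-- The functions on `Y` given by Laurent polynomials through a map `φ` from `Y` to `𝕋_N`. This is
a model of the coordinate ring of the Zariski closure of the range of `φ`. -/
def regularFunctions (φ : Y → ComplexTorus M) : Subalgebra ℂ (Y → ℂ) :=
  (AlgHom.pi fun y => evalAt (φ y)).range

theorem evalAt_single (x : ComplexTorus M) (m : M) (c : ℂ) :
    evalAt x (AddMonoidAlgebra.single m c) = c * x (Multiplicative.ofAdd m) := by
  simp [evalAt]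

theorem character_zero (φ : Y → ComplexTorus M) : character φ 0 = 1 := by
  ext; simp [character]

theorem character_add (φ : Y → ComplexTorus M) (m n : M) :
    character φ (m + n) = character φ m * character φ n := by
  ext; simp [character]

theorem character_mul_character_neg (φ : Y → ComplexTorus M) (m : M) :
    character φ m * character φ (-m) = 1 := by
  rw [← character_add, add_neg_cancel, character_zero]

theorem character_ne_zero (φ : Y → ComplexTorus M) (m : M) (y : Y) : character φ m y ≠ 0 :=
  Units.ne_zero _

theorem character_mem_regularFunctions (φ : Y → ComplexTorus M) (m : M) :
    character φ m ∈ regularFunctions φ :=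
  ⟨AddMonoidAlgebra.single m 1, funext fun y => by simp [evalAt_single, character]⟩

theorem regularFunctions_induction {φ : Y → ComplexTorus M} {p : (Y → ℂ) → Prop}
    (character : ∀ m, p (character φ m)) (add : ∀ f g, p f → p g → p (f + g))
    (smul : ∀ (c : ℂ) f, p f → p (c • f)) {f : Y → ℂ} (hf : f ∈ regularFunctions φ) : p f := by
  obtain ⟨f, rfl⟩ := hf
  change p (AlgHom.pi (fun y => evalAt (φ y)) f)
  induction f using AddMonoidAlgebra.induction_on with
  | of m =>
    convert character m using 1
    ext y
    simp [evalAt_single, Coamoeba.character]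
  | add f g hf hg => exact map_add (AlgHom.pi fun y => evalAt (φ y)) f g ▸ add _ _ hf hg
  | smul c f hf => exact map_smul (AlgHom.pi fun y => evalAt (φ y)) c f ▸ smul c _ hf

theorem finiteType_regularFunctions [Module.Finite ℤ M] (φ : Y → ComplexTorus M) :
    Algebra.FiniteType ℂ (regularFunctions φ) := by
  have : AddMonoid.FG M :=
    AddGroup.fg_iff_addMonoid_fg.1 (Module.Finite.iff_addGroup_fg.1 inferInstance)
  exact .of_surjective (AlgHom.pi fun y => evalAt (φ y)).rangeRestrict
    (AlgHom.rangeRestrict_surjective _)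

theorem vanishingIdeal_range (φ : Y → ComplexTorus M) :
    vanishingIdeal (Set.range φ) = RingHom.ker (AlgHom.pi fun y => evalAt (φ y)) := by
  ext f
  simp [vanishingIdeal, Submodule.mem_iInf, RingHom.mem_ker, funext_iff]

theorem varietyDim_range (φ : Y → ComplexTorus M) :
    varietyDim (Set.range φ) = ringKrullDim (regularFunctions φ) :=
  ringKrullDim_eq_of_ringEquiv <| (Ideal.quotEquivOfEq (vanishingIdeal_range φ)).trans
    (Ideal.quotientKerEquivRange (AlgHom.pi fun y => evalAt (φ y))).toRingEquiv

theorem varietyDim_empty : varietyDim (∅ : Set (ComplexTorus M)) = ⊥ := by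
  rw [← Set.range_eq_empty (Empty.elim : Empty → ComplexTorus M), varietyDim_range]
  exact ringKrullDim_eq_bot_of_subsingleton

theorem varietyDim_eq (X : Set (ComplexTorus M)) :
    varietyDim X = ringKrullDim (regularFunctions fun x : X => x.1) := by
  rw [← varietyDim_range, Subtype.range_coe]

theorem varietyDim_mono {X X' : Set (ComplexTorus M)} (h : X ⊆ X') :
    varietyDim X ≤ varietyDim X' :=
  ringKrullDim_le_of_surjective (Ideal.Quotient.factor (biInf_mono h))
    (Ideal.Quotient.factor_surjective _)

end RegularFunctions

section RealPoints

/-- The inclusion of the compact real torus in the complex torus. -/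
def toComplexTorus (u : RealTorus M) : ComplexTorus M := Circle.toUnits.comp u

theorem character_toComplexTorus_neg (φ : Y → RealTorus M) (m : M) :
    character (fun y => toComplexTorus (φ y)) (-m) =
      star (character (fun y => toComplexTorus (φ y)) m) := by
  ext y
  simp [character, toComplexTorus, ← Circle.coe_inv_eq_conj]

theorem ofReal_comp_mem_regularFunctions {S : Set (RealTorus M)} {f : S → ℝ}
    (hf : f ∈ polynomialFunctions S) :
    Complex.ofRealAm.compLeft S f ∈ regularFunctions fun u : S => toComplexTorus u.1 := by
  set R := regularFunctions fun u : S => toComplexTorus u.1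
  let χ := character fun u : S => toComplexTorus u.1
  have hmem (m : M) (c c' : ℂ) : c • χ m + c' • star (χ m) ∈ R := by
    rw [← character_toComplexTorus_neg]
    exact add_mem (R.smul_mem (character_mem_regularFunctions _ _) c)
      (R.smul_mem (character_mem_regularFunctions _ _) c')
  suffices polynomialFunctions S ≤ (R.restrictScalars ℝ).comap (Complex.ofRealAm.compLeft S) from
    this hf
  refine Algebra.adjoin_le (Set.union_subset ?_ ?_) <;> rintro _ ⟨m, rfl⟩
  · have hre : Complex.ofRealAm.compLeft S (fun u => (χ m u).re) =
        (1 / 2 : ℂ) • χ m + (1 / 2 : ℂ) • star (χ m) := funext fun u => by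
      refine (Complex.re_eq_add_conj (χ m u)).trans ?_
      simp only [Pi.add_apply, Pi.smul_apply, Pi.star_apply, smul_eq_mul, starRingEnd_apply]
      ring
    exact (hre ▸ hmem m _ _ : Complex.ofRealAm.compLeft S (fun u => (χ m u).re) ∈ R)
  · have him : Complex.ofRealAm.compLeft S (fun u => (χ m u).im) =
        (1 / (2 * Complex.I)) • χ m + (-1 / (2 * Complex.I)) • star (χ m) := funext fun u => by
      refine (Complex.im_eq_sub_conj (χ m u)).trans ?_
      simp only [Pi.add_apply, Pi.smul_apply, Pi.star_apply, smul_eq_mul, starRingEnd_apply]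
      ring
    exact (him ▸ hmem m _ _ : Complex.ofRealAm.compLeft S (fun u => (χ m u).im) ∈ R)

theorem isIntegral_polynomialFunctions {S : Set (RealTorus M)} {f : S → ℂ}
    (hf : f ∈ regularFunctions fun u : S => toComplexTorus u.1) :
    IsIntegral ((polynomialFunctions S).map (Complex.ofRealAm.compLeft S)) f := by
  let P := (polynomialFunctions S).map (Complex.ofRealAm.compLeft S)
  have hreal {g : S → ℝ} (hg : g ∈ polynomialFunctions S) :
      IsIntegral P (Complex.ofRealAm.compLeft S g) :=
    isIntegral_algebraMap (x := (⟨_, g, hg, rfl⟩ : P))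
  have hI : IsIntegral P (fun _ : S => Complex.I) :=
    .of_pow two_pos (by
      convert (isIntegral_one (R := P) (B := S → ℂ)).neg using 1
      exact funext fun _ => Complex.I_sq)
  refine regularFunctions_induction (fun m => ?_) (fun f g => IsIntegral.add) (fun c f hf => ?_) hf
  · have hsum := (hreal (Algebra.subset_adjoin (Or.inl ⟨m, rfl⟩))).add
      ((hreal (Algebra.subset_adjoin (Or.inr ⟨m, rfl⟩))).mul hI)
    have hχ : character (fun u : S => toComplexTorus u.1) m = fun u : S =>
        ((u.1 (Multiplicative.ofAdd m) : ℂ).re : ℂ) +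
          ((u.1 (Multiplicative.ofAdd m) : ℂ).im : ℂ) * Complex.I :=
      funext fun u => (Complex.re_add_im _).symm
    exact hχ ▸ hsum
  · have hc : IsIntegral P (fun _ : S => c) := by
      have hsum := (hreal (algebraMap_mem (polynomialFunctions S) c.re)).add
        ((hreal (algebraMap_mem (polynomialFunctions S) c.im)).mul hI)
      exact (funext fun _ => Complex.re_add_im c) ▸ hsum
    exact hc.mul hf

theorem semialgebraicDim_eq_varietyDim (S : Set (RealTorus M)) :
    semialgebraicDim S = varietyDim (toComplexTorus '' S) := by
  have hinj : Function.Injective (Complex.ofRealAm.compLeft S) :=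
    Complex.ofReal_injective.comp_left
  have hrange : toComplexTorus '' S = Set.range fun u : S => toComplexTorus u.1 :=
    Set.image_eq_range _ _
  rw [hrange, varietyDim_range, ringKrullDim_eq_of_le_of_forall_isIntegral
    (S := (polynomialFunctions S).map (Complex.ofRealAm.compLeft S))
    (by rintro _ ⟨f, hf, rfl⟩; exact ofReal_comp_mem_regularFunctions hf)
    fun f hf => isIntegral_polynomialFunctions hf]
  exact ringKrullDim_eq_of_ringEquiv
    ((polynomialFunctions S).equivMapOfInjective _ hinj).toRingEquiv

theorem semialgebraicDim_le_varietyDim_univ (S : Set (RealTorus M)) :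
    semialgebraicDim S ≤ varietyDim (Set.univ : Set (ComplexTorus M)) :=
  semialgebraicDim_eq_varietyDim S ▸ varietyDim_mono (Set.subset_univ _)

theorem semialgebraicDim_coamoeba (X : Set (ComplexTorus M)) :
    semialgebraicDim (coamoeba X) =
      ringKrullDim (regularFunctions fun x : X => toComplexTorus (argMap x.1)) := by
  rw [semialgebraicDim_eq_varietyDim, coamoeba, Set.image_image, Set.image_eq_range,
    varietyDim_range]

end RealPoints

section Conjugation

theorem character_toComplexTorus_argMap_sq (X : Set (ComplexTorus M)) (m : M) :
    character (fun x : X => toComplexTorus (argMap x.1)) m ^ 2 =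
      character (fun x : X => x.1) m * star (character (fun x : X => x.1) (-m)) := by
  ext x
  have hz : (x.1 (Multiplicative.ofAdd m) : ℂ) ≠ 0 := Units.ne_zero _
  have hn : ((‖(x.1 (Multiplicative.ofAdd m) : ℂ)‖ : ℝ) : ℂ) ≠ 0 := by simp
  change ((x.1 (Multiplicative.ofAdd m) : ℂ) / (‖(x.1 (Multiplicative.ofAdd m) : ℂ)‖ : ℂ)) ^ 2 =
    x.1 (Multiplicative.ofAdd m) * (starRingEnd ℂ) (x.1 (Multiplicative.ofAdd (-m)))
  rw [ofAdd_neg, map_inv, Units.val_inv_eq_inv_val, map_inv₀, ← div_eq_mul_inv, div_pow,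
    div_eq_div_iff (pow_ne_zero 2 hn) ((map_ne_zero _).2 hz), ← Complex.mul_conj']
  ring

theorem isIntegral_adjoin_sumElim_star {κ : Type*} {z : κ → Y → ℂ} {f : Y → ℂ}
    (hf : IsIntegral (Algebra.adjoin ℂ (Set.range z)) f) :
    IsIntegral (Algebra.adjoin ℂ (Set.range (Sum.elim z (star z)))) f ∧
      IsIntegral (Algebra.adjoin ℂ (Set.range (Sum.elim z (star z)))) (star f) := by
  have hz (f) (h : f ∈ Algebra.adjoin ℂ (Set.range z)) :
      f ∈ Algebra.adjoin ℂ (Set.range (Sum.elim z (star z))) :=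
    Algebra.adjoin_mono (by rw [Set.Sum.elim_range]; exact Set.subset_union_left) h
  have hstar (f) (h : f ∈ Algebra.adjoin ℂ (Set.range z)) :
      starRingEnd (Y → ℂ) f ∈ Algebra.adjoin ℂ (Set.range (Sum.elim z (star z))) := by
    have hstar : star f ∈ Algebra.adjoin ℂ (star (Set.range z)) := by
      rwa [← Subalgebra.star_adjoin_comm, Subalgebra.star_mem_star_iff]
    refine Algebra.adjoin_mono ?_ hstar
    rintro g ⟨j, hj⟩
    exact ⟨Sum.inr j, star_eq_iff_star_eq.1 hj.symm⟩
  exact ⟨isIntegral_map_of_forall_mem (RingHom.id _) hz hf,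
    isIntegral_map_of_forall_mem (starRingEnd _) hstar hf⟩

theorem isIntegral_adjoin_sumElim_star_of_mem_regularFunctions_argMap {κ : Type*}
    {X : Set (ComplexTorus M)} {z : κ → X → ℂ}
    (hz : ∀ f ∈ regularFunctions fun x : X => x.1, IsIntegral (Algebra.adjoin ℂ (Set.range z)) f)
    {f : X → ℂ} (hf : f ∈ regularFunctions fun x : X => toComplexTorus (argMap x.1)) :
    IsIntegral (Algebra.adjoin ℂ (Set.range (Sum.elim z (star z)))) f := by
  have hχ (m : M) := isIntegral_adjoin_sumElim_star (hz _ (character_mem_regularFunctions _ m))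
  refine regularFunctions_induction (fun m => ?_) (fun f g => IsIntegral.add)
    (fun c f => IsIntegral.smul c) hf
  refine .of_pow two_pos ?_
  rw [character_toComplexTorus_argMap_sq]
  exact (hχ m).1.mul (hχ (-m)).2

end Conjugation

section Subtorus

/-- The elements of `M` that are orthogonal to `L ⊆ N`; they are the characters of `𝕋_N` that are
trivial on the subtorus of `L`. -/
def annihilator (L : AddSubgroup (M →+ ℤ)) : Submodule ℤ M :=
  ⨅ w ∈ L, LinearMap.ker w.toIntLinearMap

variable {L : AddSubgroup (M →+ ℤ)}

theorem mem_annihilator {m : M} : m ∈ annihilator L ↔ ∀ w ∈ L, w m = 0 := by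
  simp only [annihilator, Submodule.mem_iInf, LinearMap.mem_ker, AddMonoidHom.coe_toIntLinearMap]

instance free_quotient_annihilator [Module.Finite ℤ M] : Module.Free ℤ (M ⧸ annihilator L) := by
  have : Module.IsTorsionFree ℤ (M ⧸ annihilator L) := .of_smul_eq_zero fun n q h => by
    obtain ⟨m, rfl⟩ := (annihilator L).mkQ_surjective q
    rw [← map_smul, Submodule.mkQ_apply, Submodule.Quotient.mk_eq_zero, mem_annihilator] at h
    refine or_iff_not_imp_left.2 fun hn => ?_
    rw [Submodule.mkQ_apply, Submodule.Quotient.mk_eq_zero, mem_annihilator]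
    exact fun w hw => (mul_eq_zero.1 (by simpa using h w hw)).resolve_left hn
  exact Module.free_of_finite_type_torsion_free'

theorem apply_eq_one_of_mem_annihilator {t : ComplexTorus M} (ht : t ∈ subtorusOf L) {m : M}
    (hm : m ∈ annihilator L) : t (Multiplicative.ofAdd m) = 1 := by
  suffices subtorusOf L ≤ (MonoidHom.eval (Multiplicative.ofAdd m)).ker from this ht
  refine iSup₂_le fun w hw => ?_
  rintro _ ⟨c, rfl⟩
  change c ^ w m = 1
  rw [mem_annihilator.1 hm w hw, zpow_zero]

-- Adjoining `χ + χ⁻¹` instead of both `χ` and `χ⁻¹` keeps the number of generators equal to the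
-- rank, so that it bounds the dimension of the subtorus sharply.
theorem isIntegral_adjoin_character_add_character_neg {ι : Type*} {m : ι → M}
    (hm : annihilator L ⊔ Submodule.span ℤ (Set.range m) = ⊤) {f : subtorusOf L → ℂ}
    (hf : f ∈ regularFunctions fun t : subtorusOf L => t.1) :
    IsIntegral (Algebra.adjoin ℂ (Set.range fun i =>
      character (fun t : subtorusOf L => t.1) (m i) +
        character (fun t : subtorusOf L => t.1) (-m i))) f := by
  set χ := character fun t : subtorusOf L => t.1 with hχ
  set Z := Algebra.adjoin ℂ (Set.range fun i => χ (m i) + χ (-m i))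
  let integralExponents : AddSubgroup M :=
    { carrier := {μ | IsIntegral Z (χ μ) ∧ IsIntegral Z (χ (-μ))}
      zero_mem' := by simp [hχ, character_zero, isIntegral_one]
      add_mem' := fun {μ ν} hμ hν => by
        simp only [Set.mem_ofPred_eq, neg_add, hχ, character_add]
        exact ⟨hμ.1.mul hν.1, hμ.2.mul hν.2⟩
      neg_mem' := fun {μ} hμ => ⟨hμ.2, (neg_neg μ).symm ▸ hμ.1⟩ }
  have hannihilator : annihilator L ≤ integralExponents.toIntSubmodule := fun μ hμ => by
    have h (ν) (hν : ν ∈ annihilator L) : χ ν = 1 := funext fun t => by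
      simp [hχ, character, apply_eq_one_of_mem_annihilator t.2 hν]
    exact ⟨h μ hμ ▸ isIntegral_one, h _ (neg_mem hμ) ▸ isIntegral_one⟩
  have hspan : Submodule.span ℤ (Set.range m) ≤ integralExponents.toIntSubmodule := by
    refine Submodule.span_le.2 (Set.range_subset_iff.2 fun i => ?_)
    have hmul : χ (m i) * χ (-m i) = 1 := character_mul_character_neg _ _
    have hadd : χ (m i) + χ (-m i) ∈ Z := Algebra.subset_adjoin ⟨i, rfl⟩
    refine ⟨isIntegral_of_mul_eq_one_of_add_mem hmul hadd, ?_⟩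
    rw [mul_comm] at hmul
    rw [add_comm] at hadd
    exact isIntegral_of_mul_eq_one_of_add_mem hmul hadd
  refine regularFunctions_induction (fun μ => ?_) (fun f g => IsIntegral.add)
    (fun c f => IsIntegral.smul c) hf
  exact (sup_le hannihilator hspan (hm ▸ Submodule.mem_top) : μ ∈ integralExponents).1

theorem varietyDim_subtorusOf_le_card [Module.Finite ℤ M] {ι : Type*} [Fintype ι] {m : ι → M}
    (hm : annihilator L ⊔ Submodule.span ℤ (Set.range m) = ⊤) :
    varietyDim (subtorusOf L : Set (ComplexTorus M)) ≤ Fintype.card ι := by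
  have := finiteType_regularFunctions fun t : (subtorusOf L : Set (ComplexTorus M)) => t.1
  rw [varietyDim_eq]
  exact ringKrullDim_le_card_of_isIntegral_adjoin _ _ fun f =>
    isIntegral_adjoin_character_add_character_neg hm

variable (L) in
/-- The point `2 ^ w` of the subtorus of `L`, for `w ∈ L`. Its coordinates are positive, so that
translation by it preserves arguments. -/
def twoPow : Multiplicative L →* ComplexTorus M where
  toFun w := oneParam w.toAdd.1 (Units.mk0 2 two_ne_zero)
  map_one' := by ext; simp [oneParam]
  map_mul' v w := by ext; simp [oneParam, zpow_add₀]

theorem twoPow_mem_subtorusOf (w : Multiplicative L) : twoPow L w ∈ subtorusOf L :=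
  le_iSup₂ (f := fun (w : M →+ ℤ) (_ : w ∈ L) => (oneParam w).range) w.toAdd.1 w.toAdd.2 ⟨_, rfl⟩

theorem twoPow_apply (w : Multiplicative L) (m : Multiplicative M) :
    (twoPow L w m : ℂ) = 2 ^ w.toAdd.1 m.toAdd := by
  simp [twoPow, oneParam]

theorem argMap_twoPow_mul (w : Multiplicative L) (x : ComplexTorus M) :
    argMap (twoPow L w * x) = argMap x := by
  have h : argHom (Units.mk0 2 two_ne_zero) = 1 := Circle.ext <| by
    change (2 : ℂ) / (‖(2 : ℂ)‖ : ℂ) = 1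
    simp
  change argHom.comp (twoPow L w * x) = argHom.comp x
  ext m
  simp [MonoidHom.comp_mul, twoPow, oneParam, h]

variable (L) in
/-- The character with exponent `m` restricted to the points `2 ^ w`, `w ∈ L`. -/
def weight (m : M) : Multiplicative L →* ℂ :=
  (Units.coeHom ℂ).comp ((MonoidHom.eval (Multiplicative.ofAdd m)).comp (twoPow L))

theorem prod_weight_pow_apply {ι : Type*} (m : ι → M) (α : ι →₀ ℕ) (w : Multiplicative L) :
    (α.prod fun i n => weight L (m i) ^ n) w =
      2 ^ w.toAdd.1 (Finsupp.linearCombination ℕ m α) := by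
  have hexponent : Multiplicative.ofAdd (Finsupp.linearCombination ℕ m α) =
      ∏ i ∈ α.support, Multiplicative.ofAdd (m i) ^ α i := by
    rw [Finsupp.linearCombination_apply, Finsupp.sum, ofAdd_sum]
    rfl
  refine Eq.trans ?_ (twoPow_apply w (Multiplicative.ofAdd (Finsupp.linearCombination ℕ m α)))
  simp [hexponent, Finsupp.prod, MonoidHom.finsetProd_apply, weight]

theorem injective_prod_weight_pow {ι : Type*} {m : ι → M}
    (hm : LinearIndependent ℤ fun i => (annihilator L).mkQ (m i)) :
    Function.Injective fun α : ι →₀ ℕ => α.prod fun i n => weight L (m i) ^ n := by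
  intro α β h
  have hmem : Finsupp.linearCombination ℕ m α - Finsupp.linearCombination ℕ m β ∈
      annihilator L := by
    refine mem_annihilator.2 fun w hw => ?_
    have hpow := DFunLike.congr_fun h (Multiplicative.ofAdd (⟨w, hw⟩ : L))
    simp only [prod_weight_pow_apply] at hpow
    have hpow_real : (2 : ℝ) ^ w (Finsupp.linearCombination ℕ m α) =
        2 ^ w (Finsupp.linearCombination ℕ m β) := by
      apply Complex.ofReal_injective
      push_cast
      exact hpow
    rw [map_sub, sub_eq_zero]
    exact zpow_right_injective₀ two_pos (by norm_num) hpow_real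
  have hm_nat : LinearIndependent ℕ fun i => (annihilator L).mkQ (m i) :=
    hm.restrict_scalars fun a b hab => by simpa using hab
  have hmkQ (γ : ι →₀ ℕ) : Finsupp.linearCombination ℕ (fun i => (annihilator L).mkQ (m i)) γ =
      (annihilator L).mkQ (Finsupp.linearCombination ℕ m γ) :=
    (Finsupp.apply_linearCombination ℕ ((annihilator L).mkQ.restrictScalars ℕ) m γ).symm
  refine hm_nat ?_
  rw [hmkQ, hmkQ, ← sub_eq_zero, ← map_sub]
  exact (Submodule.Quotient.mk_eq_zero _).2 hmem

theorem algebraicIndependent_character {X : Set (ComplexTorus M)} (hL : ActsOn (subtorusOf L) X)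
    {ι : Type*} {m : ι → M} (hm : LinearIndependent ℤ fun i => (annihilator L).mkQ (m i)) :
    AlgebraicIndependent (regularFunctions fun x : X => toComplexTorus (argMap x.1))
      fun i => character (fun x : X => x.1) (m i) := by
  let translate (w : Multiplicative L) (x : X) : X :=
    ⟨twoPow L w * x.1, hL _ (twoPow_mem_subtorusOf w) x.1 x.2⟩
  have hinvariant : ∀ f ∈ regularFunctions fun x : X => toComplexTorus (argMap x.1),
      ∀ w x, f (translate w x) = f x := by
    rintro _ ⟨p, rfl⟩ w x
    simp [translate, argMap_twoPow_mul]
  exact algebraicIndependent_of_semiinvariant translate (fun i => weight L (m i))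
    (injective_prod_weight_pow hm) _ hinvariant _
    (fun i w x => by simp [translate, character, weight])
    fun i x => character_ne_zero _ _ _

theorem semialgebraicDim_coamoeba_add_card_le [Module.Finite ℤ M] {X : Set (ComplexTorus M)}
    (hL : ActsOn (subtorusOf L) X) {ι : Type*} [Fintype ι] {m : ι → M}
    (hm : LinearIndependent ℤ fun i => (annihilator L).mkQ (m i)) :
    semialgebraicDim (coamoeba X) + Fintype.card ι ≤ 2 * varietyDim X := by
  obtain rfl | hX := X.eq_empty_or_nonempty
  · rw [coamoeba, Set.image_empty, semialgebraicDim_eq_varietyDim, Set.image_empty,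
      varietyDim_empty, WithBot.bot_add]
    exact bot_le
  have := hX.to_subtype
  have := finiteType_regularFunctions fun x : X => x.1
  have := finiteType_regularFunctions fun x : X => toComplexTorus (argMap x.1)
  obtain ⟨d, z, -, hz, hd⟩ :=
    exists_algebraicIndependent_isIntegral_ringKrullDim_eq (regularFunctions fun x : X => x.1)
  obtain ⟨e, y, hy, -, he⟩ := exists_algebraicIndependent_isIntegral_ringKrullDim_eq
    (regularFunctions fun x : X => toComplexTorus (argMap x.1))
  have hindep := hy.sumElim_comp (algebraicIndependent_character hL hm)
  have hcard := card_le_card_of_isIntegral_adjoin hindep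
    (Sum.elim (fun j => (z j : X → ℂ)) (star fun j => (z j : X → ℂ))) <| by
      rintro (i | j)
      · exact (isIntegral_adjoin_sumElim_star
          (hz _ (character_mem_regularFunctions _ (m i)))).1
      · exact isIntegral_adjoin_sumElim_star_of_mem_regularFunctions_argMap hz (y j).2
  simp only [Fintype.card_sum, Fintype.card_fin] at hcard
  have hle : e + Fintype.card ι ≤ 2 * d := by omega
  rw [semialgebraicDim_coamoeba, varietyDim_eq, he, hd]
  exact_mod_cast hle

theorem semialgebraicDim_coamoeba_add_varietyDim_subtorusOf_le [Module.Finite ℤ M]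
    {X : Set (ComplexTorus M)} (hL : ActsOn (subtorusOf L) X) :
    semialgebraicDim (coamoeba X) + varietyDim (subtorusOf L : Set (ComplexTorus M)) ≤
      2 * varietyDim X := by
  let b := Module.finBasis ℤ (M ⧸ annihilator L)
  choose m hm using fun i => (annihilator L).mkQ_surjective (b i)
  have hindep : LinearIndependent ℤ fun i => (annihilator L).mkQ (m i) := by
    simpa only [hm] using b.linearIndependent
  have hspan : annihilator L ⊔ Submodule.span ℤ (Set.range m) = ⊤ := by
    rw [← Submodule.map_mkQ_eq_top, Submodule.map_span, ← Set.range_comp]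
    exact (congrArg _ (congrArg Set.range (funext hm))).trans b.span_eq
  exact (add_le_add_right (varietyDim_subtorusOf_le_card hspan) _).trans
    (semialgebraicDim_coamoeba_add_card_le hL hindep)

end Subtorus

end Coamoeba

end

theorem mainTheorem4_general {M : Type*} [AddCommGroup M] [Module.Finite ℤ M]
    (X : Set (Coamoeba.ComplexTorus M)) (T : Subgroup (Coamoeba.ComplexTorus M))
    (hT : Coamoeba.IsSubtorus T) (hact : Coamoeba.ActsOn T X) :
    Coamoeba.semialgebraicDim (Coamoeba.coamoeba X) ≤
        Coamoeba.varietyDim (Set.univ : Set (Coamoeba.ComplexTorus M)) ∧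
      Coamoeba.semialgebraicDim (Coamoeba.coamoeba X) +
          Coamoeba.varietyDim (T : Set (Coamoeba.ComplexTorus M)) ≤
        2 * Coamoeba.varietyDim X := by
  obtain ⟨L, rfl⟩ := hT
  exact ⟨Coamoeba.semialgebraicDim_le_varietyDim_univ _,
    Coamoeba.semialgebraicDim_coamoeba_add_varietyDim_subtorusOf_le hact⟩

theorem mainTheorem4 {M : Type*} [AddCommGroup M] [Module.Free ℤ M] [Module.Finite ℤ M]
    (X : Set (Coamoeba.ComplexTorus M)) (hX : Coamoeba.IsSubvariety X)
    (TX : Subgroup (Coamoeba.ComplexTorus M))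
    (hTX : Coamoeba.IsLargestSubtorusActingOn TX X) :
    Coamoeba.semialgebraicDim (Coamoeba.coamoeba X) ≤
        Coamoeba.varietyDim (Set.univ : Set (Coamoeba.ComplexTorus M)) ∧
      Coamoeba.semialgebraicDim (Coamoeba.coamoeba X) +
          Coamoeba.varietyDim (TX : Set (Coamoeba.ComplexTorus M)) ≤
        2 * Coamoeba.varietyDim X :=
  mainTheorem4_general X TX hTX.1.1 hTX.1.2
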